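/- All graphs are finite, simple and undirected. For a graph $G$ on $n$ vertices let $S(G)$ be the set of all real symmetric matrices $A=[a_{ij}]$, with rows and columns indexed by the vertices of $G$, such that for $i\neq j$ one has $a_{ij}\neq 0$ if and only if $ij$ is an edge of $G$ (the diagonal entries are arbitrary). Let $\pi(A)$ and $\nu(A)$ be the numbers of positive and of negative eigenvalues of $A$, counted with multiplicity, and let $I(G)=\{(\pi(A),\nu(A)) : A\in S(G)\}$ be the inertia set of $G$. For integers $k\ge 0$, $m$, $n$ let $$T^k_{[m,n]}=\{(a,b) : a,b\in\mathbb{Z},\ a\ge k,\ b\ge k,\ m\le a+b\le n\},\qquad T_{[m,n]}=T^0_{[m,n]}.$$ A bouquet of $\alpha\geq 0$ cycles with center $v$ is a graph composed of $\alpha$ cycles that all pass through $v$ and pairwise have only $v$ in common. A generalized star of $\beta\geq 0$ paths with center $v$ is a graph composed of $\beta$ paths, each on at least two vertices and having $v$ as an endpoint, that pairwise have only $v$ in common. (For $\alpha=0$, respectively $\beta=0$, these are the one-vertex graph.) A supernova with $\alpha$ cycles and $\beta$ pendant paths is the graph obtained from a bouquet of $\alpha$ cycles and a generalized star of $\beta$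 paths by identifying their centers. **Lemma.** If $G$ is a supernova on $n$ vertices with $\alpha$ cycles and $\beta$ pendant paths, then $$I(G)=T_{[n-\alpha-1,n]}\cup T^1_{[n-\alpha-\beta+1,n]}.$$ -/

import Mathlib

namespace SimpleGraph

/-- `G` is composed of the walks `w i`, all of which start at `v`, joined at the common vertex `v`:
two different walks have only the vertex `v` in common, every vertex other than `v` lies on one of
the walks, and every edge of `G` is an edge of one of the walks. -/
def IsComposedAt {V : Type*} (G : SimpleGraph V) (v : V) {ι : Type*} {e : ι → V}
    (w : (i : ι) → G.Walk v (e i)) : Prop :=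
  (∀ i j, i ≠ j → ∀ x, x ∈ (w i).support → x ∈ (w j).support → x = v) ∧
  (∀ x, x = v ∨ ∃ i, x ∈ (w i).support) ∧
  (∀ x y, G.Adj x y → ∃ i, s(x, y) ∈ (w i).edges)

/-- `G` is a generalized star with center `v`, composed of `p` paths on at least two vertices, all
having `v` as an endpoint, joined at `v`. For `p = 0` this is the graph with the single vertex
`v`. -/
def IsGeneralizedStar {V : Type*} (G : SimpleGraph V) (v : V) (p : ℕ) : Prop :=
  ∃ (e : Fin p → V) (w : (i : Fin p) → G.Walk v (e i)),
    (∀ i, (w i).IsPath ∧ 1 ≤ (w i).length) ∧ G.IsComposedAt v w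

/-- `G` is a bouquet with center `v`, composed of `k` cycles joined at `v`. For `k = 0` this is the
graph with the single vertex `v`. -/
def IsBouquet {V : Type*} (G : SimpleGraph V) (v : V) (k : ℕ) : Prop :=
  ∃ c : Fin k → G.Walk v v, (∀ i, (c i).IsCycle) ∧ G.IsComposedAt v c

/-- `G` is the join of its subgraphs `F` and `H` at `v`: they have exactly the vertex `v` in common,
and `G` is their union. -/
def IsJoinAt {V : Type*} (G : SimpleGraph V) (v : V) (F H : G.Subgraph) : Prop :=
  F.verts ∩ H.verts = {v} ∧ F ⊔ H = ⊤

/-- `G` is a supernova with `α` cycles and `β` pendant paths: the join, at their common center `v`,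
of a bouquet of `α` cycles and a generalized star of `β` paths. -/
def IsSupernova {V : Type*} (G : SimpleGraph V) (α β : ℕ) : Prop :=
  ∃ (v : V) (B S : G.Subgraph) (hB : v ∈ B.verts) (hS : v ∈ S.verts),
    G.IsJoinAt v B S ∧ B.coe.IsBouquet ⟨v, hB⟩ α ∧ S.coe.IsGeneralizedStar ⟨v, hS⟩ β

/-- The real matrix `A` is a realization of `G`: it is symmetric, and an off-diagonal entry is
nonzero exactly when there is an edge. There is no condition on the diagonal. -/
def IsRealization {V : Type*} (G : SimpleGraph V) (A : Matrix V V ℝ) : Prop :=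
  A.IsSymm ∧ ∀ i j, i ≠ j → (A i j ≠ 0 ↔ G.Adj i j)

end SimpleGraph

/-- The number of positive eigenvalues of a real matrix, with multiplicity. -/
noncomputable def Matrix.numPosEigenvalues {V : Type*} [Fintype V] [DecidableEq V]
    (A : Matrix V V ℝ) : ℕ :=
  (A.charpoly.roots.filter (fun x => 0 < x)).card

/-- The number of negative eigenvalues of a real matrix, with multiplicity. -/
noncomputable def Matrix.numNegEigenvalues {V : Type*} [Fintype V] [DecidableEq V]
    (A : Matrix V V ℝ) : ℕ :=
  (A.charpoly.roots.filter (fun x => x < 0)).card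

/-- The inertia set `I(G)`: all pairs (number of positive eigenvalues, number of negative
eigenvalues) of realizations of `G`. -/
def SimpleGraph.inertiaSet {V : Type*} [Fintype V] [DecidableEq V] (G : SimpleGraph V) :
    Set (ℕ × ℕ) :=
  {q | ∃ A : Matrix V V ℝ, G.IsRealization A ∧
    q = (A.numPosEigenvalues, A.numNegEigenvalues)}

/-- The set `T^k_[m,n]` of pairs of natural numbers with both entries at least `k` and with sum
between `m` and `n` (the bounds are integers, so that no subtraction truncates). -/
def inertiaTrapezoid (k : ℕ) (m n : ℤ) : Set (ℕ × ℕ) :=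
  {q | k ≤ q.1 ∧ k ≤ q.2 ∧ m ≤ (q.1 : ℤ) + q.2 ∧ (q.1 : ℤ) + q.2 ≤ n}

/-! ### Rank, inertia and congruence of real symmetric matrices. -/

namespace Matrix

/-! Remove the center `v`: what remains is one path per branch, where a cycle is a branch with both
ends attached to `v` and a pendant path a branch with one end attached.

Upper bound. As `π + ν` is the rank, only the nullity has to be bounded, by zero forcing: a kernel
vector that vanishes on a suitable vertex set vanishes everywhere. With two pendant paths, the far
end of one of them and the first vertex of every other branch but the second one force everything,
so the nullity is at most `α + β - 1`. With at most one pendant path, `v` and one neighbour of it on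
each cycle suffice, so the nullity is at most `α + 1`. The latter bound also holds if `π = 0` or `ν
= 0`, because for a semidefinite matrix a kernel vector vanishing at `v` restricts to a kernel
vector on each pendant path (`card_le_rank_add_of_posSemidef`). This is why the larger nullity needs
`π, ν ≥ 1`.

Realization. By Sylvester's law, `Mᵀ D M` with `M` invertible has the inertia of the diagonal matrix
`D`. In each construction the rows of `M` are chosen so that the pattern of `G` appears while a
fixed number of diagonal entries of `D` remain free: `α + 1` in the first, `α + β - 1` in the
second, where a hyperbolic pair at `v` costs one positive and one negative eigenvalue. -/

/-- If a vector in the kernel is determined by its coordinates in `F`, then the nullity is at most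
the cardinality of `F`. -/
theorem card_le_rank_add_card {V : Type*} [Fintype V] {A : Matrix V V ℝ} (F : Finset V)
    (hF : ∀ x : V → ℝ, A *ᵥ x = 0 → (∀ z ∈ F, x z = 0) → x = 0) :
    Fintype.card V ≤ A.rank + F.card := by
  let f : LinearMap.ker A.mulVecLin →ₗ[ℝ] (F → ℝ) :=
    (LinearMap.funLeft ℝ ℝ (fun z : F => (z : V))) ∘ₗ (LinearMap.ker A.mulVecLin).subtype
  have hf : Function.Injective f := by
    rw [← LinearMap.ker_eq_bot, LinearMap.ker_eq_bot']
    rintro ⟨x, hx⟩ h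
    refine Subtype.ext (hF x (by simpa using hx) fun z hz => ?_)
    exact congrFun h ⟨z, hz⟩
  have h1 := LinearMap.finrank_le_finrank_of_injective hf
  have h2 := LinearMap.finrank_range_add_finrank_ker A.mulVecLin
  rw [Module.finrank_fintype_fun_eq_card] at h1 h2
  rw [Fintype.card_coe] at h1
  rw [Matrix.rank]
  lia

variable {V : Type*} [Fintype V] [DecidableEq V] {A : Matrix V V ℝ}

theorem numPosEigenvalues_eq_card (hA : A.IsHermitian) :
    A.numPosEigenvalues = (Finset.univ.filter fun i => 0 < hA.eigenvalues i).card := by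
  rw [numPosEigenvalues, hA.roots_charpoly_eq_eigenvalues, Multiset.filter_map, Multiset.card_map]
  rfl

theorem numNegEigenvalues_eq_card (hA : A.IsHermitian) :
    A.numNegEigenvalues = (Finset.univ.filter fun i => hA.eigenvalues i < 0).card := by
  rw [numNegEigenvalues, hA.roots_charpoly_eq_eigenvalues, Multiset.filter_map, Multiset.card_map]
  rfl

/-- The quadratic form of `Mᵀ D M` at `x` is that of `D` at `M x`, so `M` itself is the isometry. -/
theorem equivalent_weightedSumSquares_of_eq {M : Matrix V V ℝ} (hM : IsUnit M) (d : V → ℝ)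
    (h : A = Mᵀ * diagonal d * M) :
    (A.toQuadraticForm').Equivalent (QuadraticMap.weightedSumSquares ℝ d) := by
  refine ⟨{ toLinearEquiv := LinearEquiv.ofBijective M.mulVecLin ?_, map_app' := fun x => ?_ }⟩
  · exact ⟨mulVec_injective_iff_isUnit.2 hM, mulVec_surjective_iff_isUnit.2 hM⟩
  · have h1 : A.toQuadraticForm' x = x ⬝ᵥ A *ᵥ x := by
      simp [toQuadraticForm', toLinearMap₂'_apply']
    change QuadraticMap.weightedSumSquares ℝ d (M *ᵥ x) = _
    rw [h1, QuadraticMap.weightedSumSquares_apply, h, ← mulVec_mulVec, ← mulVec_mulVec,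
      dotProduct_mulVec, vecMul_transpose, dotProduct]
    refine Finset.sum_congr rfl fun i _ => ?_
    rw [mulVec_diagonal, smul_eq_mul]
    ring

/-- **Sylvester's law of inertia** for a real matrix congruent to a diagonal one. -/
theorem numEigenvalues_of_eq_transpose_mul_diagonal_mul {M : Matrix V V ℝ} (hM : IsUnit M)
    (d : V → ℝ) (h : A = Mᵀ * diagonal d * M) :
    A.numPosEigenvalues = (Finset.univ.filter fun i => 0 < d i).card ∧
      A.numNegEigenvalues = (Finset.univ.filter fun i => d i < 0).card := by
  have hA : A.IsHermitian := by
    rw [IsHermitian, h]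
    simp [mul_assoc]
  have hU : IsUnit (star (hA.eigenvectorUnitary : Matrix V V ℝ)) :=
    (Unitary.isUnit_coe (U := hA.eigenvectorUnitary)).star
  -- The spectral theorem is a second congruence of `A` with a diagonal matrix; signatures of
  -- equivalent weighted sums of squares agree.
  have hs : A = (star (hA.eigenvectorUnitary : Matrix V V ℝ))ᵀ * diagonal hA.eigenvalues *
      star (hA.eigenvectorUnitary : Matrix V V ℝ) := by
    conv_lhs => rw [hA.spectral_theorem, Unitary.conjStarAlgAut_apply]
    simp [star_eq_conjTranspose]
  have e1 := equivalent_weightedSumSquares_of_eq hM d h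
  have e2 := equivalent_weightedSumSquares_of_eq hU _ hs
  rw [numPosEigenvalues_eq_card hA, numNegEigenvalues_eq_card hA]
  have p := (QuadraticForm.sigPos_of_equiv_weightedSumSquares e2).symm.trans
    (QuadraticForm.sigPos_of_equiv_weightedSumSquares e1)
  have q := (QuadraticForm.sigNeg_of_equiv_weightedSumSquares e2).symm.trans
    (QuadraticForm.sigNeg_of_equiv_weightedSumSquares e1)
  simpa [Set.ncard_eq_toFinset_card'] using And.intro p q

theorem numPosEigenvalues_add_numNegEigenvalues (hA : A.IsHermitian) :
    A.numPosEigenvalues + A.numNegEigenvalues = A.rank := by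
  rw [hA.rank_eq_card_non_zero_eigs, numPosEigenvalues_eq_card hA, numNegEigenvalues_eq_card hA,
    Fintype.card_subtype, ← Finset.card_union_of_disjoint]
  · congr 1
    ext i
    simp only [Finset.mem_filter, Finset.mem_univ, true_and, Finset.mem_union]
    exact ne_iff_lt_or_gt.trans or_comm |>.symm
  · rw [Finset.disjoint_filter]
    intro i _ h1 h2
    exact lt_asymm h1 h2

theorem posSemidef_of_numNegEigenvalues_eq_zero (hA : A.IsHermitian)
    (h : A.numNegEigenvalues = 0) : A.PosSemidef := by
  rw [hA.posSemidef_iff_eigenvalues_nonneg]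
  rw [numNegEigenvalues_eq_card hA, Finset.card_eq_zero, Finset.filter_eq_empty_iff] at h
  exact fun i => not_lt.1 (h (Finset.mem_univ i))

theorem posSemidef_neg_of_numPosEigenvalues_eq_zero (hA : A.IsHermitian)
    (h : A.numPosEigenvalues = 0) : (-A).PosSemidef := by
  rw [numPosEigenvalues_eq_card hA, Finset.card_eq_zero, Finset.filter_eq_empty_iff] at h
  have hs := hA.spectral_theorem
  have hd : (diagonal fun i => -hA.eigenvalues i).PosSemidef :=
    posSemidef_diagonal_iff.2 fun i => neg_nonneg.2 (not_lt.1 (h (Finset.mem_univ i)))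
  have := hd.mul_mul_conjTranspose_same (hA.eigenvectorUnitary : Matrix V V ℝ)
  convert this using 1
  conv_lhs => rw [hs, Unitary.conjStarAlgAut_apply]
  rw [show (diagonal fun i => -hA.eigenvalues i) = -diagonal hA.eigenvalues from
    (diagonal_neg hA.eigenvalues).symm, star_eq_conjTranspose, Matrix.mul_neg, Matrix.neg_mul]
  rfl

end Matrix

/-- There are sign vectors with support between `U \ F` and `U` and with any number of positive and
of negative entries that this allows. -/
theorem exists_sign_vector {V : Type*} [Fintype V] [DecidableEq V] {F U : Finset V} (hF : F ⊆ U)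
    {a b : ℕ} (h1 : U.card ≤ a + b + F.card) (h2 : a + b ≤ U.card) :
    ∃ d : V → ℝ, (∀ z, z ∉ U → d z = 0) ∧
      (∀ z, z ∈ U → z ∉ F → d z ≠ 0) ∧
      (Finset.univ.filter fun i => 0 < d i).card = a ∧
      (Finset.univ.filter fun i => d i < 0).card = b := by
  obtain ⟨S, hFS, hSU, hS⟩ := Finset.exists_subsuperset_card_eq (s := U \ F) (t := U) (n := a + b)
    Finset.sdiff_subset (by rw [Finset.card_sdiff_of_subset hF]; lia) h2
  obtain ⟨P, hPS, hP⟩ := Finset.exists_subset_card_eq (s := S) (n := a) (by lia)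
  refine ⟨fun z => if z ∈ P then 1 else if z ∈ S then -1 else 0, fun z hz => ?_,
    fun z hz hzF => ?_, ?_, ?_⟩
  · have : z ∉ S := fun h => hz (hSU h)
    simp [this, show z ∉ P from fun h => this (hPS h)]
  · have : z ∈ S := hFS (Finset.mem_sdiff.2 ⟨hz, hzF⟩)
    dsimp only
    rw [if_pos this]
    split_ifs <;> norm_num
  · rw [← hP]
    congr 1
    ext z
    by_cases h : z ∈ P <;> by_cases h' : z ∈ S <;> simp [h, h']
  · have : S.card = (S \ P).card + P.card := (Finset.card_sdiff_add_card_eq_card hPS).symm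
    rw [show b = (S \ P).card by lia]
    congr 1
    ext z
    by_cases h : z ∈ P <;> by_cases h' : z ∈ S <;> simp [h, h']

namespace SimpleGraph

theorem IsRealization.isHermitian {V : Type*} {G : SimpleGraph V} {A : Matrix V V ℝ}
    (h : G.IsRealization A) : A.IsHermitian := by
  rw [Matrix.IsHermitian, Matrix.conjTranspose_eq_transpose_of_trivial]
  exact h.1

theorem Iso.inertiaSet_subset {V W : Type*} [Fintype V] [DecidableEq V] [Fintype W] [DecidableEq W]
    {G : SimpleGraph V} {H : SimpleGraph W} (e : G ≃g H) : G.inertiaSet ⊆ H.inertiaSet := by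
  rintro _ ⟨A, hA, rfl⟩
  refine ⟨A.reindex e.toEquiv e.toEquiv, ⟨?_, fun i j hij => ?_⟩, ?_⟩
  · ext i j
    exact hA.1.apply _ _
  · have : e.symm i ≠ e.symm j := fun h => hij (e.symm.injective h)
    exact (hA.2 _ _ this).trans e.symm.map_adj_iff
  · simp only [Matrix.numPosEigenvalues, Matrix.numNegEigenvalues, Matrix.charpoly_reindex]

theorem Iso.inertiaSet_eq {V W : Type*} [Fintype V] [DecidableEq V] [Fintype W] [DecidableEq W]
    {G : SimpleGraph V} {H : SimpleGraph W} (e : G ≃g H) : G.inertiaSet = H.inertiaSet :=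
  e.inertiaSet_subset.antisymm e.symm.inertiaSet_subset

end SimpleGraph

/-! ### A normal form for graphs made of branches at a center. -/

namespace SimpleGraph

/-- The graph with center `none` and branches `i : ι`, where branch `i` consists of the vertices
`⟨i, 0⟩, …, ⟨i, len i - 1⟩` in this order. The first vertex of every branch is adjacent to the
center, and the last vertex of the branches in `C` is as well. -/
def novaGraph {ι : Type*} (len : ι → ℕ) (C : Finset ι) :
    SimpleGraph (Option (Σ i, Fin (len i))) where
  Adj
    | none, none => False
    | none, some y => (y.2 : ℕ) = 0 ∨ y.1 ∈ C ∧ (y.2 : ℕ) + 1 = len y.1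
    | some x, none => (x.2 : ℕ) = 0 ∨ x.1 ∈ C ∧ (x.2 : ℕ) + 1 = len x.1
    | some x, some y => x.1 = y.1 ∧ ((x.2 : ℕ) + 1 = y.2 ∨ (y.2 : ℕ) + 1 = x.2)
  symm := ⟨by
    rintro (_ | x) (_ | y) h
    · exact h
    · exact h
    · exact h
    · exact ⟨h.1.symm, h.2.symm⟩⟩
  loopless := ⟨by
    rintro (_ | x) h
    · exact h
    · have := h.2
      lia⟩

section

variable {ι : Type*} {len : ι → ℕ} {C : Finset ι}

theorem novaGraph_adj_none_some {y : Σ i, Fin (len i)} :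
    (novaGraph len C).Adj none (some y) ↔
      (y.2 : ℕ) = 0 ∨ y.1 ∈ C ∧ (y.2 : ℕ) + 1 = len y.1 := Iff.rfl

theorem novaGraph_adj_some_some {x y : Σ i, Fin (len i)} :
    (novaGraph len C).Adj (some x) (some y) ↔
      x.1 = y.1 ∧ ((x.2 : ℕ) + 1 = y.2 ∨ (y.2 : ℕ) + 1 = x.2) := Iff.rfl

/-- The `k`-th vertex on the closed walk along branch `i` that starts at the center. -/
def novaNode (len : ι → ℕ) (i : ι) (k : ℕ) : Option (Σ i, Fin (len i)) :=
  -- The default value `none` is taken both at `k = 0` and at `k = len i + 1`, so the walk returns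
  -- to the center.
  if h : 0 < k ∧ k - 1 < len i then some ⟨i, ⟨k - 1, h.2⟩⟩ else none

theorem novaNode_zero (i : ι) : novaNode len i 0 = none := by
  simp [novaNode]

theorem novaNode_succ {i : ι} {k : ℕ} (h : k < len i) :
    novaNode len i (k + 1) = some ⟨i, ⟨k, h⟩⟩ := by
  simp [novaNode, h]

theorem novaNode_len_succ (i : ι) : novaNode len i (len i + 1) = none := by
  simp [novaNode]

/-- This lists edges as steps of walks, the form in which the edges of a composed graph are given. A
branch in `C` has one more step, back to the center. -/
theorem novaGraph_adj_iff [DecidableEq ι] (hlen : ∀ i, 1 ≤ len i)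
    {a b : Option (Σ i, Fin (len i))} :
    (novaGraph len C).Adj a b ↔ ∃ i k, k < len i + (if i ∈ C then 1 else 0) ∧
      s(novaNode len i k, novaNode len i (k + 1)) = s(a, b) := by
  constructor
  · have key : ∀ y : Σ i, Fin (len i), (novaGraph len C).Adj none (some y) →
        ∃ i k, k < len i + (if i ∈ C then 1 else 0) ∧
          s(novaNode len i k, novaNode len i (k + 1)) = s(none, some y) := by
      rintro ⟨i, y, hy⟩ (h | ⟨h, h'⟩)
      · dsimp only at h
        subst h
        exact ⟨i, 0, by lia, by rw [novaNode_zero, novaNode_succ hy]⟩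
      · dsimp only at h h'
        refine ⟨i, y + 1, by simp [h, h'], ?_⟩
        rw [novaNode_succ hy, h', novaNode_len_succ, Sym2.eq_swap]
    have key' : ∀ (i : ι) (k : ℕ) (hk : k + 1 < len i),
        ∃ i' k', k' < len i' + (if i' ∈ C then 1 else 0) ∧
          s(novaNode len i' k', novaNode len i' (k' + 1)) =
            s(some ⟨i, ⟨k, by lia⟩⟩, some ⟨i, ⟨k + 1, hk⟩⟩) := fun i k hk =>
      ⟨i, k + 1, by lia, by rw [novaNode_succ hk, novaNode_succ]⟩
    intro h
    rcases a with _ | ⟨i, x, hx⟩ <;> rcases b with _ | ⟨j, y, hy⟩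
    · exact h.elim
    · exact key _ h
    · obtain ⟨i', k', h, h'⟩ := key _ h.symm
      exact ⟨i', k', h, h'.trans Sym2.eq_swap⟩
    · obtain ⟨h1, h2⟩ := h
      dsimp only at h1 h2
      subst h1
      rcases h2 with rfl | rfl
      · exact key' i x hy
      · obtain ⟨i', k', h, h'⟩ := key' i y hx
        exact ⟨i', k', h, h'.trans Sym2.eq_swap⟩
  · rintro ⟨i, k, hk, h⟩
    suffices h' : (novaGraph len C).Adj (novaNode len i k) (novaNode len i (k + 1)) by
      rwa [← mem_edgeSet, h] at h'
    rcases k with _ | k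
    · rw [novaNode_zero, novaNode_succ (hlen i)]
      exact Or.inl rfl
    · rcases lt_or_ge (k + 1) (len i) with h1 | h1
      · rw [novaNode_succ h1, novaNode_succ (by lia)]
        exact ⟨rfl, Or.inl rfl⟩
      · have hi : i ∈ C := by
          by_contra hi
          simp only [hi, if_false] at hk
          lia
        simp only [hi, if_true] at hk
        have h2 : k + 1 = len i := by lia
        rw [novaNode_succ (by lia), h2, novaNode_len_succ]
        exact Or.inr ⟨hi, h2⟩

/-- A graph composed of closed or open trails that meet only in their starting point is a
`novaGraph`. -/
theorem nonempty_novaGraph_iso {V : Type*} {G : SimpleGraph V} [DecidableEq ι] (v : V)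
    (f : ι → ℕ → V) (hlen : ∀ i, 1 ≤ len i) (h0 : ∀ i, f i 0 = v)
    (hC : ∀ i ∈ C, f i (len i + 1) = v)
    (hv : ∀ i k, 1 ≤ k → k ≤ len i → f i k ≠ v)
    (hinj : ∀ i k l, 1 ≤ k → k ≤ len i → 1 ≤ l → l ≤ len i → f i k = f i l → k = l)
    (hdisj : ∀ i j k l, i ≠ j → 1 ≤ k → k ≤ len i → 1 ≤ l → l ≤ len j → f i k ≠ f j l)
    (hcov : ∀ x, x = v ∨ ∃ i k, 1 ≤ k ∧ k ≤ len i ∧ f i k = x)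
    (hadj : ∀ x y, G.Adj x y ↔ ∃ i k, k < len i + (if i ∈ C then 1 else 0) ∧
      s(f i k, f i (k + 1)) = s(x, y)) :
    Nonempty (novaGraph len C ≃g G) := by
  let φ : Option (Σ i, Fin (len i)) → V := fun a => a.elim v fun x => f x.1 (x.2 + 1)
  have hφ : Function.Bijective φ := by
    constructor
    · rintro (_ | ⟨i, x, hx⟩) (_ | ⟨j, y, hy⟩) h
      · rfl
      · exact (hv j (y + 1) (by lia) (by lia) h.symm).elim
      · exact (hv i (x + 1) (by lia) (by lia) h).elim
      · rcases eq_or_ne i j with rfl | hij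
        · have := hinj i (x + 1) (y + 1) (by lia) (by lia) (by lia) (by lia) h
          simp only [Option.some.injEq, Sigma.mk.injEq, heq_eq_eq, true_and, Fin.mk.injEq]
          lia
        · exact (hdisj i j (x + 1) (y + 1) hij (by lia) (by lia) (by lia) (by lia) h).elim
    · intro x
      rcases hcov x with rfl | ⟨i, k, hk, hk', rfl⟩
      · exact ⟨none, rfl⟩
      · exact ⟨some ⟨i, ⟨k - 1, by lia⟩⟩, by simp [φ, show k - 1 + 1 = k by lia]⟩
  have hnode : ∀ i k, k ≤ len i + (if i ∈ C then 1 else 0) → φ (novaNode len i k) = f i k := by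
    intro i k hk
    rcases k with _ | k
    · rw [novaNode_zero, h0]
      rfl
    · rcases lt_or_ge k (len i) with h | h
      · rw [novaNode_succ h]
        rfl
      · have hi : i ∈ C := by
          by_contra hi
          simp only [hi, if_false] at hk
          lia
        simp only [hi, if_true] at hk
        obtain rfl : k = len i := by lia
        rw [novaNode_len_succ, hC i hi]
        rfl
  refine ⟨⟨Equiv.ofBijective φ hφ, ?_⟩⟩
  intro a b
  change G.Adj (φ a) (φ b) ↔ _
  rw [hadj, novaGraph_adj_iff hlen]
  refine exists_congr fun i => exists_congr fun k => and_congr_right fun hk => ?_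
  rw [← hnode i k hk.le, ← hnode i (k + 1) hk]
  exact (Sym2.map.injective hφ.injective).eq_iff (a := s(_, _)) (b := s(_, _))

end

end SimpleGraph

/-! ### Supernovas in normal form. -/

namespace SimpleGraph

theorem Walk.exists_pos_getVert_eq {V : Type*} {G : SimpleGraph V} {v u x : V} {w : G.Walk v u}
    (h : x ∈ w.support) (hx : x ≠ v) : ∃ k, 1 ≤ k ∧ k ≤ w.length ∧ w.getVert k = x := by
  obtain ⟨k, rfl, hk⟩ := Walk.mem_support_iff_exists_getVert.1 h
  refine ⟨k, Nat.one_le_iff_ne_zero.2 ?_, hk, rfl⟩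
  rintro rfl
  exact hx w.getVert_zero

theorem IsSupernova.exists_novaGraph_iso {V : Type*} {G : SimpleGraph V} {α β : ℕ}
    (hG : G.IsSupernova α β) :
    ∃ len : Fin α ⊕ Fin β → ℕ, (∀ i, 1 ≤ len i) ∧ (∀ i, 2 ≤ len (Sum.inl i)) ∧
      Nonempty (novaGraph len (Finset.univ.filter fun i => i.isLeft) ≃g G) := by
  obtain ⟨v, B, S, hB, hS, ⟨hV, hT⟩, ⟨c, hc, hcd, hcc, hce⟩, ⟨e, w, hw, hwd, hwc, hwe⟩⟩ := hG
  have hc3 : ∀ i, 3 ≤ (c i).length := fun i => (hc i).three_le_length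
  -- On a cycle the vertices are distinct only for indices from `1` to the length, so the center is
  -- compared at the last index instead of at `0`.
  have hcv : ∀ i k, 1 ≤ k → k ≤ (c i).length - 1 → ((c i).getVert k : V) ≠ v := by
    intro i k h1 h2 h
    have := (hc i).getVert_injOn (x₁ := k) (x₂ := (c i).length) ⟨h1, by lia⟩
      ⟨by have := hc3 i; lia, le_rfl⟩ (by rw [Walk.getVert_length]; exact Subtype.ext h)
    have := hc3 i
    lia
  have hwv : ∀ i k, 1 ≤ k → k ≤ (w i).length → ((w i).getVert k : V) ≠ v := by
    intro i k h1 h2 h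
    have := (hw i).1.getVert_injOn (x₁ := k) (x₂ := 0) h2 (Nat.zero_le _)
      (by rw [Walk.getVert_zero]; exact Subtype.ext h)
    lia
  have hcross : ∀ (x : B.verts) (y : S.verts), (x : V) = y → (x : V) = v := by
    intro x y h
    have : (x : V) ∈ B.verts ∩ S.verts := ⟨x.2, h ▸ y.2⟩
    rwa [hV] at this
  -- Branch lengths count vertices other than the center: one less than the length of a cycle,
  -- exactly the length of a path.
  refine ⟨Sum.elim (fun i => (c i).length - 1) (fun j => (w j).length), ?_, ?_, ?_⟩
  · rintro (i | j)
    · have := hc3 i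
      simp only [Sum.elim_inl]
      lia
    · exact (hw j).2
  · intro i
    have := hc3 i
    simp only [Sum.elim_inl]
    lia
  refine nonempty_novaGraph_iso v
    (Sum.elim (fun i k => ((c i).getVert k : V)) (fun j k => ((w j).getVert k : V)))
    ?_ ?_ ?_ ?_ ?_ ?_ ?_ ?_
  · rintro (i | j)
    · have := hc3 i
      simp only [Sum.elim_inl]
      lia
    · exact (hw j).2
  · rintro (i | j) <;> simp
  · rintro (i | j) hi
    · have := hc3 i
      simp [show (c i).length - 1 + 1 = (c i).length by lia]
    · simp at hi
  · rintro (i | j)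
    · exact hcv i
    · exact hwv j
  · rintro (i | j) k l h1 h2 h3 h4 h <;> simp only [Sum.elim_inl, Sum.elim_inr] at h2 h4 h
    · exact (hc i).getVert_injOn ⟨h1, by lia⟩ ⟨h3, by lia⟩ (Subtype.ext h)
    · exact (hw j).1.getVert_injOn h2 h4 (Subtype.ext h)
  · rintro (i | i) (j | j) k l hij h1 h2 h3 h4 h <;>
      simp only [Sum.elim_inl, Sum.elim_inr] at h2 h4 h
    · have := hcd i j (fun h => hij (congrArg _ h)) _ ((c i).getVert_mem_support k)
        (by rw [Subtype.ext h]; exact (c j).getVert_mem_support l)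
      exact hcv i k h1 h2 (congrArg Subtype.val this)
    · exact hcv i k h1 h2 (hcross _ _ h)
    · exact hcv j l h3 h4 (hcross _ _ h.symm)
    · have := hwd i j (fun h => hij (congrArg _ h)) _ ((w i).getVert_mem_support k)
        (by rw [Subtype.ext h]; exact (w j).getVert_mem_support l)
      exact hwv i k h1 h2 (congrArg Subtype.val this)
  · intro x
    rw [or_iff_not_imp_left]
    intro hx
    have : x ∈ (B ⊔ S).verts := by rw [hT]; trivial
    rcases this with h | h
    · obtain h' | ⟨i, h'⟩ := hcc ⟨x, h⟩
      · exact (hx (congrArg Subtype.val h')).elim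
      · obtain ⟨k, h1, h2, h3⟩ := Walk.exists_pos_getVert_eq h'
          fun h => hx (congrArg Subtype.val h)
        refine ⟨Sum.inl i, k, h1, ?_, congrArg Subtype.val h3⟩
        have : k ≠ (c i).length := by
          rintro rfl
          rw [Walk.getVert_length] at h3
          exact hx (congrArg Subtype.val h3).symm
        simp only [Sum.elim_inl]
        lia
    · obtain h' | ⟨i, h'⟩ := hwc ⟨x, h⟩
      · exact (hx (congrArg Subtype.val h')).elim
      · obtain ⟨k, h1, h2, h3⟩ := Walk.exists_pos_getVert_eq h'
          fun h => hx (congrArg Subtype.val h)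
        exact ⟨Sum.inr i, k, h1, h2, congrArg Subtype.val h3⟩
  · intro x y
    constructor
    · intro h
      have : (B ⊔ S).Adj x y := by rw [hT]; exact h
      rcases this with h | h
      · obtain ⟨i, hi⟩ := hce ⟨x, B.edge_vert h⟩ ⟨y, B.edge_vert h.symm⟩ h
        obtain ⟨k, hk, hk'⟩ := (Walk.mk_mem_edges_iff_exists _).1 hi
        refine ⟨Sum.inl i, k, ?_, congrArg (Sym2.map Subtype.val) hk'⟩
        simp only [Sum.elim_inl, Finset.mem_filter, Finset.mem_univ, Sum.isLeft_inl, and_self,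
          if_true]
        lia
      · obtain ⟨i, hi⟩ := hwe ⟨x, S.edge_vert h⟩ ⟨y, S.edge_vert h.symm⟩ h
        obtain ⟨k, hk, hk'⟩ := (Walk.mk_mem_edges_iff_exists _).1 hi
        exact ⟨Sum.inr i, k, Nat.lt_add_right _ hk, congrArg (Sym2.map Subtype.val) hk'⟩
    · rintro ⟨i | i, k, hk, h⟩ <;> rw [← mem_edgeSet, ← h]
      · have := hc3 i
        simp only [Sum.elim_inl, Finset.mem_filter, Finset.mem_univ, Sum.isLeft_inl, and_self,
          if_true] at hk
        exact B.adj_sub ((c i).adj_getVert_succ (by lia))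
      · simp at hk
        exact S.adj_sub ((w i).adj_getVert_succ hk)

end SimpleGraph

/-! ### Upper bound: nullity by zero forcing. -/

namespace SimpleGraph

open Matrix

/-- The zero forcing rule: if `x` vanishes at `z` and at all neighbours of `z` but possibly `u`,
then it vanishes at `u` as well. -/
theorem IsRealization.eq_zero_of_forced {V : Type*} [Fintype V] {G : SimpleGraph V}
    {A : Matrix V V ℝ} (hA : G.IsRealization A) {x : V → ℝ} {z u : V} (h : (A *ᵥ x) z = 0)
    (hz : x z = 0) (hu : G.Adj z u) (hy : ∀ y, y ≠ u → G.Adj z y → x y = 0) : x u = 0 := by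
  have h1 : (A *ᵥ x) z = A z u * x u := by
    refine Finset.sum_eq_single u (fun y _ hyu => ?_) (by simp)
    by_cases hyz : z = y
    · rw [← hyz, hz, mul_zero]
    · change A z y * x y = 0
      by_cases hadj : G.Adj z y
      · rw [hy y hyu hadj, mul_zero]
      · rw [not_not.1 (mt (hA.2 z y hyz).1 hadj), zero_mul]
  rw [h1] at h
  exact (mul_eq_zero.1 h).resolve_left ((hA.2 z u hu.ne).2 hu)

section

variable {ι : Type*} [Fintype ι] {len : ι → ℕ} {C : Finset ι}
  {A : Matrix (Option (Σ i, Fin (len i))) (Option (Σ i, Fin (len i))) ℝ}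
  {x : Option (Σ i, Fin (len i)) → ℝ}

/-- Each vertex forces the next one. This also works on cycles, since the value at the center is
already zero. -/
theorem branch_eq_zero_of_first (hA : (novaGraph len C).IsRealization A) (h0 : x none = 0) {i : ι}
    (hx : ∀ k, (A *ᵥ x) (some ⟨i, k⟩) = 0)
    (hi : ∀ k : Fin (len i), (k : ℕ) = 0 → x (some ⟨i, k⟩) = 0) (k : Fin (len i)) :
    x (some ⟨i, k⟩) = 0 := by
  obtain ⟨k, hk⟩ := k
  induction k using Nat.strong_induction_on with
  | _ k ih =>
    rcases k with _ | k
    · exact hi _ rfl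
    · refine hA.eq_zero_of_forced (hx ⟨k, by lia⟩) (ih k (by lia) _) ⟨rfl, Or.inl rfl⟩ ?_
      rintro (_ | ⟨j, l, hl⟩) hne hadj
      · exact h0
      · obtain ⟨h1, h2⟩ := hadj
        dsimp only at h1 h2
        subst h1
        have : l ≠ k + 1 := by
          rintro rfl
          exact hne rfl
        exact ih l (by lia) _

/-- Forcing inwards from the free end of a pendant path needs nothing about the center: only the
first vertex is adjacent to it. -/
theorem branch_eq_zero_of_last (hA : (novaGraph len C).IsRealization A) {i : ι} (hiC : i ∉ C)
    (hx : ∀ k, (A *ᵥ x) (some ⟨i, k⟩) = 0)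
    (hi : ∀ k : Fin (len i), (k : ℕ) + 1 = len i → x (some ⟨i, k⟩) = 0) (k : Fin (len i)) :
    x (some ⟨i, k⟩) = 0 := by
  obtain ⟨k, hk⟩ := k
  induction h : len i - k using Nat.strong_induction_on generalizing k with
  | _ m ih =>
    by_cases hl : k + 1 = len i
    · exact hi _ hl
    · refine hA.eq_zero_of_forced (hx ⟨k + 1, by lia⟩) (ih _ (by lia) _ (by lia) rfl)
        ⟨rfl, Or.inr rfl⟩ ?_
      rintro (_ | ⟨j, l, hl'⟩) hne hadj
      · obtain h2 | ⟨h2, -⟩ := hadj.symm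
        · exact absurd h2 (by simp)
        · exact absurd h2 hiC
      · obtain ⟨h1, h2⟩ := hadj
        dsimp only at h1 h2
        subst h1
        have : l ≠ k := by
          rintro rfl
          exact hne rfl
        exact ih _ (by lia) l (by lia) rfl

theorem center_eq_zero_of_branch (hA : (novaGraph len C).IsRealization A) {i : ι}
    (hlen : 1 ≤ len i) (hx : ∀ k, (A *ᵥ x) (some ⟨i, k⟩) = 0)
    (hi : ∀ k : Fin (len i), x (some ⟨i, k⟩) = 0) : x none = 0 := by
  have hadj₀ : (novaGraph len C).Adj (some ⟨i, ⟨0, hlen⟩⟩) none := Or.inl rfl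
  refine hA.eq_zero_of_forced (hx ⟨0, hlen⟩) (hi _) hadj₀ ?_
  rintro (_ | ⟨j, l⟩) hne hadj
  · exact (hne rfl).elim
  · obtain ⟨h1, h2⟩ := hadj
    dsimp only at h1
    subst h1
    exact hi l

/-- A pendant path has a single neighbour of the center, so once all other branches vanish the
center forces it. -/
theorem first_eq_zero_of_center (hA : (novaGraph len C).IsRealization A) (h0 : x none = 0)
    {i : ι} (hiC : i ∉ C) (hx : (A *ᵥ x) none = 0)
    (hi : ∀ j, j ≠ i → ∀ k, x (some ⟨j, k⟩) = 0) (k : Fin (len i)) (hk : (k : ℕ) = 0) :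
    x (some ⟨i, k⟩) = 0 := by
  have hadj₀ : (novaGraph len C).Adj none (some ⟨i, k⟩) := Or.inl hk
  refine hA.eq_zero_of_forced hx h0 hadj₀ ?_
  rintro (_ | ⟨j, l⟩) hne hadj
  · exact h0
  · obtain rfl | hji := eq_or_ne j i
    · obtain h2 | ⟨h2, -⟩ := hadj
      · exact (hne (by rw [show l = k from Fin.ext (h2.trans hk.symm)])).elim
      · exact (hiC h2).elim
    · exact hi j hji l

variable [DecidableEq ι]

/-- The bound on the nullity by zero forcing from the end of one pendant path. -/
theorem card_lt_rank_add_of_two_paths (hA : (novaGraph len C).IsRealization A)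
    (hlen : ∀ i, 1 ≤ len i) {i₀ i₁ : ι} (hi₀ : i₀ ∉ C) (hi₁ : i₁ ∉ C) (hne : i₀ ≠ i₁) :
    Fintype.card (Option (Σ i, Fin (len i))) + 1 ≤ A.rank + Fintype.card ι := by
  -- The far end of `i₀` forces `i₀` and then the center; first vertices force the other branches;
  -- `i₁` is left for the center to force, which saves one vertex.
  let s : ι → Option (Σ i, Fin (len i)) := fun i =>
    some ⟨i, if i = i₀ then ⟨len i - 1, by have := hlen i; lia⟩ else ⟨0, hlen i⟩⟩
  have key := card_le_rank_add_card (A := A) ((Finset.univ.erase i₁).image s) ?_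
  · have h1 := Finset.card_image_le (s := Finset.univ.erase i₁) (f := s)
    rw [Finset.card_erase_of_mem (Finset.mem_univ _), Finset.card_univ] at h1
    have : 0 < Fintype.card ι := Fintype.card_pos_iff.2 ⟨i₀⟩
    lia
  · intro x hx hF
    have hF' : ∀ i, i ≠ i₁ → x (s i) = 0 := fun i hi =>
      hF _ (Finset.mem_image_of_mem _ (Finset.mem_erase.2 ⟨hi, Finset.mem_univ _⟩))
    have hx' : ∀ z, (A *ᵥ x) z = 0 := fun z => congrFun hx z
    have hb₀ : ∀ k, x (some ⟨i₀, k⟩) = 0 := by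
      refine branch_eq_zero_of_last hA hi₀ (fun k => hx' _) fun k hk => ?_
      have := hF' i₀ hne
      simp only [s, if_true] at this
      rwa [show k = ⟨len i₀ - 1, by have := hlen i₀; lia⟩ from Fin.ext (by simp only; lia)]
    have h0 := center_eq_zero_of_branch hA (hlen i₀) (fun k => hx' _) hb₀
    have hb : ∀ i, i ≠ i₁ → ∀ k, x (some ⟨i, k⟩) = 0 := by
      intro i hi
      by_cases hii : i = i₀
      · subst hii
        exact hb₀
      · refine branch_eq_zero_of_first hA h0 (fun k => hx' _) fun k hk => ?_
        have := hF' i hi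
        simp only [s, hii, if_false] at this
        rwa [show k = ⟨0, hlen i⟩ from Fin.ext hk]
    have hb₁ := branch_eq_zero_of_first hA h0 (fun k => hx' _)
      (first_eq_zero_of_center hA h0 hi₁ (hx' _) hb)
    funext z
    rcases z with _ | ⟨i, k⟩
    · exact h0
    · by_cases hi : i = i₁
      · subst hi
        exact hb₁ k
      · exact hb i hi k

/-- The bound on the nullity by zero forcing from the center and the first vertices of the
cycles, when the vanishing on the pendant paths is known. -/
theorem card_le_rank_add_of_paths_forced (hA : (novaGraph len C).IsRealization A)
    (hlen : ∀ i, 1 ≤ len i)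
    (hP : ∀ x, A *ᵥ x = 0 → x none = 0 → (∀ i ∈ C, ∀ k, x (some ⟨i, k⟩) = 0) →
      ∀ i, i ∉ C → ∀ k : Fin (len i), (k : ℕ) = 0 → x (some ⟨i, k⟩) = 0) :
    Fintype.card (Option (Σ i, Fin (len i))) ≤ A.rank + (C.card + 1) := by
  let s : ι → Option (Σ i, Fin (len i)) := fun i => some ⟨i, ⟨0, hlen i⟩⟩
  refine (card_le_rank_add_card (A := A) (insert none (C.image s)) ?_).trans ?_
  · intro x hx hF
    have h0 : x none = 0 := hF _ (Finset.mem_insert_self _ _)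
    have hC : ∀ i ∈ C, ∀ k, x (some ⟨i, k⟩) = 0 := fun i hi =>
      branch_eq_zero_of_first hA h0 (fun k => congrFun hx _) fun k hk => by
        rw [show k = ⟨0, hlen i⟩ from Fin.ext hk]
        exact hF _ (Finset.mem_insert_of_mem (Finset.mem_image_of_mem s hi))
    funext z
    rcases z with _ | ⟨i, k⟩
    · exact h0
    · by_cases hi : i ∈ C
      · exact hC i hi k
      · exact branch_eq_zero_of_first hA h0 (fun k => congrFun hx _) (hP x hx h0 hC i hi) k
  · have h1 := Finset.card_insert_le (none : Option (Σ i, Fin (len i))) (C.image s)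
    have h2 := Finset.card_image_le (s := C) (f := s)
    lia

theorem card_le_rank_add_of_paths_subsingleton (hA : (novaGraph len C).IsRealization A)
    (hlen : ∀ i, 1 ≤ len i) (hC : ∀ i j, i ∉ C → j ∉ C → i = j) :
    Fintype.card (Option (Σ i, Fin (len i))) ≤ A.rank + (C.card + 1) := by
  refine card_le_rank_add_of_paths_forced hA hlen fun x hx h0 hxC i hi =>
    first_eq_zero_of_center hA h0 hi (congrFun hx _) fun j hj => hxC j ?_
  by_contra hjC
  exact hj (hC j i hjC hi)

/-- Let `x` be a kernel vector with value zero at the center and `y` its restriction to one pendant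
path. Then `yᵀ A y = 0`, so `A y = 0` by semidefiniteness, and the row of the center has only the
term of the first vertex of that path. Hence no pendant path needs a forcing vertex. -/
theorem card_le_rank_add_of_posSemidef (hA : (novaGraph len C).IsRealization A)
    (hlen : ∀ i, 1 ≤ len i) (hpos : A.PosSemidef) :
    Fintype.card (Option (Σ i, Fin (len i))) ≤ A.rank + (C.card + 1) := by
  refine card_le_rank_add_of_paths_forced hA hlen fun x hx h0 _ i hi k hk => ?_
  let y : Option (Σ i, Fin (len i)) → ℝ := fun z =>
    z.elim 0 fun p => if p.1 = i then x (some p) else 0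
  -- The branch has neighbours outside itself only at the center, where `x` vanishes.
  have hxy : ∀ k, (A *ᵥ y) (some ⟨i, k⟩) = (A *ᵥ x) (some ⟨i, k⟩) := by
    intro k
    refine Finset.sum_congr rfl fun z _ => ?_
    rcases z with _ | p
    · simp [y, h0]
    · by_cases hp : p.1 = i
      · simp [y, hp]
      · have hne : (some ⟨i, k⟩ : Option (Σ i, Fin (len i))) ≠ some p := by
          rintro h
          rw [← Option.some.inj h] at hp
          exact hp rfl
        have hz : A (some ⟨i, k⟩) (some p) = 0 := by
          by_contra h
          exact hp ((hA.2 _ _ hne).1 h).1.symm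
        change A _ _ * _ = A _ _ * _
        rw [hz, zero_mul, zero_mul]
  have hy : A *ᵥ y = 0 := by
    rw [← hpos.dotProduct_mulVec_zero_iff]
    refine Finset.sum_eq_zero fun z _ => ?_
    rcases z with _ | ⟨j, l⟩
    · simp [y]
    · by_cases hj : j = i
      · subst hj
        rw [hxy, hx, Pi.zero_apply, mul_zero]
      · simp [y, hj]
  have := first_eq_zero_of_center (x := y) hA rfl hi (congrFun hy _)
    (fun j hj k => by simp [y, hj]) k hk
  simpa [y] using this

theorem IsRealization.neg {V : Type*} {G : SimpleGraph V} {A : Matrix V V ℝ}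
    (hA : G.IsRealization A) : G.IsRealization (-A) :=
  ⟨hA.1.neg, fun i j hij => by simpa using hA.2 i j hij⟩

theorem rank_neg {V : Type*} [Fintype V] (A : Matrix V V ℝ) : (-A).rank = A.rank := by
  have : (-A).mulVecLin = -A.mulVecLin := by
    ext
    simp
  rw [Matrix.rank, Matrix.rank, this, LinearMap.range_neg]

theorem inertiaSet_novaGraph_subset (hlen : ∀ i, 1 ≤ len i) {n α β : ℕ} (hα : C.card = α)
    (hβ : Fintype.card ι = α + β) (hn : Fintype.card (Option (Σ i, Fin (len i))) = n) :
    (novaGraph len C).inertiaSet ⊆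
      inertiaTrapezoid 0 ((n : ℤ) - α - 1) n ∪ inertiaTrapezoid 1 ((n : ℤ) - α - β + 1) n := by
  rintro _ ⟨A, hA, rfl⟩
  have hr := numPosEigenvalues_add_numNegEigenvalues hA.isHermitian
  have hrn : A.rank ≤ n := hn ▸ A.rank_le_card_width
  have hfirst : n ≤ A.rank + (α + 1) → (A.numPosEigenvalues, A.numNegEigenvalues) ∈
      inertiaTrapezoid 0 ((n : ℤ) - α - 1) n ∪ inertiaTrapezoid 1 ((n : ℤ) - α - β + 1) n := by
    intro h
    refine Or.inl ⟨Nat.zero_le _, Nat.zero_le _, ?_, ?_⟩ <;> dsimp only <;> lia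
  rcases Nat.eq_zero_or_pos A.numPosEigenvalues with h1 | h1
  · refine hfirst ?_
    have := card_le_rank_add_of_posSemidef hA.neg hlen
      (posSemidef_neg_of_numPosEigenvalues_eq_zero hA.isHermitian h1)
    rwa [rank_neg, hn, hα] at this
  rcases Nat.eq_zero_or_pos A.numNegEigenvalues with h2 | h2
  · refine hfirst ?_
    have := card_le_rank_add_of_posSemidef hA hlen
      (posSemidef_of_numNegEigenvalues_eq_zero hA.isHermitian h2)
    rwa [hn, hα] at this
  by_cases hC : ∀ i j, i ∉ C → j ∉ C → i = j
  · refine hfirst ?_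
    have := card_le_rank_add_of_paths_subsingleton hA hlen hC
    rwa [hn, hα] at this
  · push Not at hC
    obtain ⟨i₀, i₁, hi₀, hi₁, hne⟩ := hC
    have := card_lt_rank_add_of_two_paths hA hlen hi₀ hi₁ hne
    rw [hn, hβ] at this
    refine Or.inr ⟨h1, h2, ?_, ?_⟩ <;> dsimp only <;> lia

end

end SimpleGraph

/-! ### Congruences by bidiagonal branch matrices. -/

namespace SimpleGraph

open Matrix

theorem transpose_mul_diagonal_mul_isSymm {V : Type*} [Fintype V] [DecidableEq V]
    (M : Matrix V V ℝ) (d : V → ℝ) : (Mᵀ * diagonal d * M).IsSymm := by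
  rw [IsSymm]
  simp [Matrix.mul_assoc]

theorem novaGraph_isRealization_of_entries {ι : Type*} {len : ι → ℕ} {C : Finset ι}
    {A : Matrix (Option (Σ i, Fin (len i))) (Option (Σ i, Fin (len i))) ℝ} (hA : A.IsSymm)
    (h0 : ∀ y, A none (some y) ≠ 0 ↔ (novaGraph len C).Adj none (some y))
    (h : ∀ x y, x ≠ y → (A (some x) (some y) ≠ 0 ↔ (novaGraph len C).Adj (some x) (some y))) :
    (novaGraph len C).IsRealization A := by
  refine ⟨hA, ?_⟩
  rintro (_ | x) (_ | y) hxy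
  · exact (hxy rfl).elim
  · exact h0 y
  · rw [← hA.apply, adj_comm]
    exact h0 x
  · exact h x y fun h => hxy (congrArg some h)

section

variable {ι : Type*} [DecidableEq ι] {len : ι → ℕ}

/-- The unitriangular matrix whose rows are `e_v` for the center `v` and
`e_(i,k) + p i k • e_(i,k-1) + q i k • e_v` for the vertex `k` of branch `i`. -/
def branchMatrix (len : ι → ℕ) (p q : ι → ℕ → ℝ) :
    Matrix (Option (Σ i, Fin (len i))) (Option (Σ i, Fin (len i))) ℝ
  | none, none => 1
  | none, some _ => 0
  | some x, none => q x.1 x.2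
  | some x, some y =>
    if x.1 = y.1 then
      if (x.2 : ℕ) = y.2 then 1 else if (x.2 : ℕ) = y.2 + 1 then p x.1 x.2 else 0
    else 0

variable {p q : ι → ℕ → ℝ}

theorem branchMatrix_none_none : branchMatrix len p q none none = 1 := rfl

theorem branchMatrix_none_some (x : Σ i, Fin (len i)) :
    branchMatrix len p q none (some x) = 0 := rfl

theorem branchMatrix_some_none (x : Σ i, Fin (len i)) :
    branchMatrix len p q (some x) none = q x.1 x.2 := rfl

theorem branchMatrix_some_some (x y : Σ i, Fin (len i)) :
    branchMatrix len p q (some x) (some y) =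
      if x.1 = y.1 then
        if (x.2 : ℕ) = y.2 then 1 else if (x.2 : ℕ) = y.2 + 1 then p x.1 x.2 else 0
      else 0 := rfl

variable [Fintype ι]

theorem sum_mul_branchMatrix (f : Option (Σ i, Fin (len i)) → ℝ) (i : ι) (k : Fin (len i)) :
    ∑ z, f z * branchMatrix len p q z (some ⟨i, k⟩) =
      f (some ⟨i, k⟩) +
        if h : (k : ℕ) + 1 < len i then f (some ⟨i, ⟨k + 1, h⟩⟩) * p i (k + 1) else 0 := by
  rw [Fintype.sum_option, branchMatrix_none_some, mul_zero, zero_add, Fintype.sum_sigma,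
    Fintype.sum_eq_single i]
  · simp only [branchMatrix_some_some, if_true]
    have hsplit : ∀ l : Fin (len i), f (some ⟨i, l⟩) *
        (if (l : ℕ) = k then 1 else if (l : ℕ) = k + 1 then p i l else 0) =
        (if l = k then f (some ⟨i, l⟩) else 0) +
          if (l : ℕ) = k + 1 then f (some ⟨i, l⟩) * p i l else 0 := by
      intro l
      by_cases h1 : l = k
      · subst h1
        simp
      · have h1' : (l : ℕ) ≠ k := fun h => h1 (Fin.ext h)
        simp [h1, h1']
    rw [Finset.sum_congr rfl fun l _ => hsplit l, Finset.sum_add_distrib, Finset.sum_ite_eq']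
    congr 1
    · simp
    · split_ifs with h
      · rw [Fintype.sum_eq_single ⟨k + 1, h⟩]
        · simp
        · intro l hl
          rw [if_neg]
          exact fun h' => hl (Fin.ext h')
      · refine Finset.sum_eq_zero fun l _ => if_neg ?_
        have := l.2
        lia
  · intro j hj
    refine Finset.sum_eq_zero fun l _ => ?_
    rw [branchMatrix_some_some, if_neg hj, mul_zero]

/-- Forward substitution along the branch. The alternative in `hi` allows rows to be replaced by
direct knowledge of a coordinate, as `isUnit_splitMatrix` requires. -/
theorem branchMatrix_branch_eq_zero {x : Option (Σ i, Fin (len i)) → ℝ} (h0 : x none = 0) {i : ι}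
    (hi : ∀ k, (branchMatrix len p q *ᵥ x) (some ⟨i, k⟩) = 0 ∨ x (some ⟨i, k⟩) = 0)
    (k : Fin (len i)) : x (some ⟨i, k⟩) = 0 := by
  obtain ⟨k, hk⟩ := k
  induction k using Nat.strong_induction_on with
  | _ k ih =>
    refine (hi ⟨k, hk⟩).elim (fun h => ?_) id
    rw [← h, mulVec, dotProduct, Fintype.sum_eq_single (some ⟨i, ⟨k, hk⟩⟩)]
    · simp [branchMatrix_some_some]
    · rintro (_ | ⟨j, l, hl⟩) hne
      · rw [h0, mul_zero]
      · rw [branchMatrix_some_some]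
        dsimp only
        split_ifs with h1 h2 h3
        · subst h1 h2
          exact (hne rfl).elim
        · subst h1
          rw [ih l (by lia), mul_zero]
        · rw [zero_mul]
        · rw [zero_mul]

theorem isUnit_branchMatrix : IsUnit (branchMatrix len p q) := by
  rw [← mulVec_injective_iff_isUnit, ← coe_mulVecLin, ← LinearMap.ker_eq_bot,
    LinearMap.ker_eq_bot']
  intro x hx
  rw [mulVecLin_apply] at hx
  have h0 : x none = 0 := by
    have := congrFun hx none
    rw [mulVec, dotProduct, Fintype.sum_option, branchMatrix_none_none] at this
    simpa [branchMatrix_none_some] using this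
  funext z
  rcases z with _ | ⟨i, k⟩
  · exact h0
  · exact branchMatrix_branch_eq_zero h0 (fun k => Or.inl (congrFun hx _)) k

/-- The entries of `Mᵀ * diagonal d * M` in the columns other than that of the center. -/
theorem transpose_mul_diagonal_mul_branchMatrix_apply (d : Option (Σ i, Fin (len i)) → ℝ)
    (x : Option (Σ i, Fin (len i))) (i : ι) (k : Fin (len i)) :
    ((branchMatrix len p q)ᵀ * diagonal d * branchMatrix len p q) x (some ⟨i, k⟩) =
      branchMatrix len p q (some ⟨i, k⟩) x * d (some ⟨i, k⟩) +
        if h : (k : ℕ) + 1 < len i then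
          branchMatrix len p q (some ⟨i, ⟨k + 1, h⟩⟩) x * d (some ⟨i, ⟨k + 1, h⟩⟩) * p i (k + 1)
        else 0 := by
  rw [mul_apply, sum_mul_branchMatrix]
  simp only [mul_diagonal, transpose_apply]

/-- The entry between vertices `k - 1` and `k` of a branch is `p i k` times the weight of row `k`.
Row `0` contributes only to the diagonal here, so its weight may be zero. -/
theorem transpose_mul_diagonal_mul_branchMatrix_ne_zero_iff {C : Finset ι}
    {d : Option (Σ i, Fin (len i)) → ℝ} (hp : ∀ i k, k ≠ 0 → k < len i → p i k ≠ 0)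
    (hd : ∀ i (k : Fin (len i)), (k : ℕ) ≠ 0 → d (some ⟨i, k⟩) ≠ 0)
    {x y : Σ i, Fin (len i)} (hxy : x ≠ y) :
    ((branchMatrix len p q)ᵀ * diagonal d * branchMatrix len p q) (some x) (some y) ≠ 0 ↔
      (novaGraph len C).Adj (some x) (some y) := by
  obtain ⟨j, l, hl⟩ := x
  obtain ⟨i, k, hk⟩ := y
  rw [transpose_mul_diagonal_mul_branchMatrix_apply, novaGraph_adj_some_some]
  simp only [branchMatrix_some_some]
  by_cases hij : i = j
  · subst hij
    have hkl : k ≠ l := by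
      rintro rfl
      exact hxy rfl
    simp only [if_true, hkl, if_false, true_and]
    by_cases h1 : k = l + 1
    · subst h1
      have := hp i (l + 1) (by lia) hk
      have := hd i ⟨l + 1, hk⟩ (by simp)
      simp [show l + 1 + 1 ≠ l by lia, *]
    · by_cases h2 : k + 1 = l
      · subst h2
        have := hp i (k + 1) (by lia) hl
        have := hd i ⟨k + 1, hl⟩ (by simp)
        simp [*]
      · simp [h1, h2, hkl, Ne.symm h1]
  · simp [hij, Ne.symm hij]

end

end SimpleGraph

/-! ### Realizing the first trapezoid. -/

namespace SimpleGraph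

open Matrix

section

variable {ι : Type*} [Fintype ι] [DecidableEq ι] {len : ι → ℕ} {C : Finset ι}

/-- The first trapezoid is realized by matrices of rank at least `n - |C| - 1`: sums of signed
rank one matrices, one for each edge of a pendant path and one for each of the triangles into which
a cycle is divided by the chords through the center, where the entries at the chords cancel. -/
theorem trapezoid_zero_subset_inertiaSet_novaGraph (hlen : ∀ i, 1 ≤ len i)
    (hC : ∀ i ∈ C, 2 ≤ len i) {n α : ℕ} (hα : C.card = α)
    (hn : Fintype.card (Option (Σ i, Fin (len i))) = n) :
    inertiaTrapezoid 0 ((n : ℤ) - α - 1) n ⊆ (novaGraph len C).inertiaSet := by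
  rintro ⟨a, b⟩ ⟨-, -, h1, h2⟩
  dsimp only at h1 h2
  let s : ι → Option (Σ i, Fin (len i)) := fun i => some ⟨i, ⟨0, hlen i⟩⟩
  have hs : Function.Injective s := by
    intro i j h
    exact congrArg Sigma.fst (Option.some.inj h)
  -- The free weights are those of the center and of row `0` of each cycle, `α + 1` in all; these
  -- rows create no edge.
  obtain ⟨d, -, hd, hda, hdb⟩ := exists_sign_vector (F := insert none (C.image s))
    (U := Finset.univ) (Finset.subset_univ _) (a := a) (b := b)
    (by
      rw [Finset.card_insert_of_notMem (by simp [s]), Finset.card_image_of_injective _ hs,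
        Finset.card_univ]
      lia)
    (by rw [Finset.card_univ]; lia)
  replace hd : ∀ i (k : Fin (len i)), i ∉ C ∨ (k : ℕ) ≠ 0 → d (some ⟨i, k⟩) ≠ 0 := by
    intro i k h
    refine hd _ (Finset.mem_univ _) ?_
    rw [Finset.mem_insert, not_or, Finset.mem_image]
    refine ⟨by simp, ?_⟩
    rintro ⟨j, hj, hjk⟩
    obtain rfl : j = i := congrArg Sigma.fst (Option.some.inj hjk)
    have : k = ⟨0, hlen j⟩ := by simpa [s] using hjk.symm
    rcases h with h | h
    · exact h hj
    · exact h (by rw [this])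
  -- The entry at the chord from the center to vertex `k - 1` of a cycle is the weight of row `k -
  -- 1` plus `p i k` times that of row `k`; this value cancels it. At `k = 1` there is no
  -- cancellation, since vertex `0` is a true neighbour.
  let p : ι → ℕ → ℝ := fun i k =>
    if h : i ∈ C ∧ 2 ≤ k ∧ k < len i then
      -(d (some ⟨i, ⟨k - 1, by lia⟩⟩) / d (some ⟨i, ⟨k, h.2.2⟩⟩)) else 1
  -- The center occurs in row `0` of a pendant path and in every row but row `0` of a cycle.
  let q : ι → ℕ → ℝ := fun i k => if i ∈ C ↔ k = 0 then 0 else 1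
  have hp : ∀ i k, k ≠ 0 → k < len i → p i k ≠ 0 := by
    intro i k hk hki
    simp only [p]
    split_ifs with h
    · exact neg_ne_zero.2 (div_ne_zero (hd i _ (Or.inr (by simp only; lia)))
        (hd i _ (Or.inr (by simp only; lia))))
    · exact one_ne_zero
  refine ⟨(branchMatrix len p q)ᵀ * diagonal d * branchMatrix len p q, ?_, ?_⟩
  · refine novaGraph_isRealization_of_entries (transpose_mul_diagonal_mul_isSymm _ _) ?_
      fun x y hxy => transpose_mul_diagonal_mul_branchMatrix_ne_zero_iff hp
        (fun i k hk => hd i k (Or.inr hk)) hxy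
    rintro ⟨i, k, hk⟩
    rw [transpose_mul_diagonal_mul_branchMatrix_apply, novaGraph_adj_none_some]
    simp only [branchMatrix_some_none, q]
    by_cases hi : i ∈ C
    · have h2 := hC i hi
      rcases k with _ | k
      · have hd1 := hd i ⟨1, h2⟩ (by simp)
        have hp1 := hp i 1 (by simp) h2
        simp [hi, show 1 < len i from h2, hd1, hp1]
      · have hdk := hd i ⟨k + 1, hk⟩ (by simp)
        by_cases hk' : k + 1 + 1 < len i
        · have hdk' := hd i ⟨k + 1 + 1, hk'⟩ (by simp)
          have : p i (k + 1 + 1) =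
              -(d (some ⟨i, ⟨k + 1, hk⟩⟩) / d (some ⟨i, ⟨k + 1 + 1, hk'⟩⟩)) := by
            simp only [p]
            rw [dif_pos ⟨hi, by lia, hk'⟩]
            rfl
          simp only [hi, this, hk', hk'.ne]
          simp [mul_div_cancel₀, hdk']
        · simp [hi, hdk, show k + 1 + 1 = len i by lia]
    · have hdk := hd i ⟨k, hk⟩ (Or.inl hi)
      by_cases hk0 : k = 0 <;> simp [hi, hk0]
      subst hk0
      exact hdk
  · obtain ⟨hpos, hneg⟩ := numEigenvalues_of_eq_transpose_mul_diagonal_mul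
      (isUnit_branchMatrix (len := len) (p := p) (q := q)) d rfl
    rw [hpos, hneg, hda, hdb]

end

end SimpleGraph

/-! ### Realizing the second trapezoid. -/

namespace SimpleGraph

open Matrix

section

variable {ι : Type*} [Fintype ι] [DecidableEq ι] {len : ι → ℕ} {C : Finset ι}

/-- The indicator vector of the neighbourhood of the center. -/
def centerNeighbors (len : ι → ℕ) (C : Finset ι) (z : Option (Σ i, Fin (len i))) : ℝ :=
  z.elim 0 fun y => if (y.2 : ℕ) = 0 ∨ y.1 ∈ C ∧ (y.2 : ℕ) + 1 = len y.1 then 1 else 0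

/-- The matrix with rows `e_v + w` and `e_v - w` at the center `v` and at `t`, where `w` is the
indicator vector of the neighbourhood of `v`, and with rows `e_(i,k) + e_(i,k-1)` elsewhere. -/
noncomputable def splitMatrix (len : ι → ℕ) (C : Finset ι) (t : Option (Σ i, Fin (len i))) :
    Matrix (Option (Σ i, Fin (len i))) (Option (Σ i, Fin (len i))) ℝ := fun z x =>
  if z = none then (Pi.single none 1 + centerNeighbors len C : _ → ℝ) x
  else if z = t then (Pi.single none 1 - centerNeighbors len C : _ → ℝ) x
  else branchMatrix len 1 0 z x

/-- The two special rows give `x v = 0` and `w ⬝ᵥ x = 0`. Substitution kills all branches but `i₀`,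
and as `i₀` is a pendant path, `w` meets it only in its first vertex, the coordinate whose row was
replaced. -/
theorem isUnit_splitMatrix {i₀ : ι} (hi₀ : i₀ ∉ C) (h : 0 < len i₀) :
    IsUnit (splitMatrix len C (some ⟨i₀, ⟨0, h⟩⟩)) := by
  rw [← mulVec_injective_iff_isUnit, ← coe_mulVecLin, ← LinearMap.ker_eq_bot,
    LinearMap.ker_eq_bot']
  intro x hx
  rw [mulVecLin_apply] at hx
  have e1 : (Pi.single none 1 + centerNeighbors len C) ⬝ᵥ x = 0 := by
    simpa only [splitMatrix, mulVec, Pi.zero_apply, if_true] using congrFun hx none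
  have e2 : (Pi.single none 1 - centerNeighbors len C) ⬝ᵥ x = 0 := by
    simpa only [splitMatrix, mulVec, Pi.zero_apply, if_true, reduceCtorEq, if_false] using
      congrFun hx (some ⟨i₀, ⟨0, h⟩⟩)
  rw [add_dotProduct, single_one_dotProduct] at e1
  rw [sub_dotProduct, single_one_dotProduct] at e2
  have h0 : x none = 0 := by linarith
  have hw : centerNeighbors len C ⬝ᵥ x = 0 := by linarith
  have hN : ∀ i k, (⟨i, k⟩ : Σ i, Fin (len i)) ≠ ⟨i₀, ⟨0, h⟩⟩ →
      (branchMatrix len 1 0 *ᵥ x) (some ⟨i, k⟩) = 0 := by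
    intro i k hik
    have := congrFun hx (some ⟨i, k⟩)
    simpa [splitMatrix, mulVec, hik] using this
  have hne : ∀ i, i ≠ i₀ → ∀ k, x (some ⟨i, k⟩) = 0 := fun i hi =>
    branchMatrix_branch_eq_zero h0 fun k => Or.inl (hN i k fun h => hi (congrArg Sigma.fst h))
  have hfirst : x (some ⟨i₀, ⟨0, h⟩⟩) = 0 := by
    rw [dotProduct, Fintype.sum_eq_single (some ⟨i₀, ⟨0, h⟩⟩)] at hw
    · simpa [centerNeighbors] using hw
    · rintro (_ | ⟨j, k⟩) hz
      · rw [h0, mul_zero]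
      · by_cases hj : j = i₀
        · subst hj
          have : (k : ℕ) ≠ 0 := by
            intro hk
            exact hz (by rw [show k = ⟨0, h⟩ from Fin.ext hk])
          simp [centerNeighbors, this, hi₀]
        · rw [hne j hj, mul_zero]
  funext z
  rcases z with _ | ⟨i, k⟩
  · exact h0
  · by_cases hi : i = i₀
    · subst hi
      refine branchMatrix_branch_eq_zero (p := 1) (q := 0) h0 (fun k => ?_) k
      by_cases hk : (⟨i, k⟩ : Σ i, Fin (len i)) = ⟨i, ⟨0, h⟩⟩
      · rw [hk]
        exact Or.inr hfirst
      · exact Or.inl (hN i k hk)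
    · exact hne i hi k

/-- With `u` the unit vector of the center, `(u + w)(u + w)ᵀ - (u - w)(u - w)ᵀ = 2 (u wᵀ + w uᵀ)`:
all edges at the center for one positive and one negative weight. As `d` vanishes at the center and
at `t`, the replaced rows are not missed in the branch part. -/
theorem splitMatrix_transpose_mul_diagonal_mul_apply {t : Option (Σ i, Fin (len i))}
    (ht : t ≠ none) {d : Option (Σ i, Fin (len i)) → ℝ} (h0 : d none = 0) (hdt : d t = 0)
    (x y : Option (Σ i, Fin (len i))) :
    ((splitMatrix len C t)ᵀ * diagonal (fun z => if z = none then 1 else if z = t then -1 else d z) *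
      splitMatrix len C t) x y =
      ((branchMatrix len 1 0)ᵀ * diagonal d * branchMatrix len 1 0 :
        Matrix (Option (Σ i, Fin (len i))) (Option (Σ i, Fin (len i))) ℝ) x y +
      2 * ((Pi.single none 1 : Option (Σ i, Fin (len i)) → ℝ) x * centerNeighbors len C y +
        centerNeighbors len C x * (Pi.single none 1 : Option (Σ i, Fin (len i)) → ℝ) y) := by
  set u : Option (Σ i, Fin (len i)) → ℝ := Pi.single none 1 with hu
  set w := centerNeighbors len C with hw
  rw [mul_apply, mul_apply]
  simp only [mul_diagonal, transpose_apply]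
  have key : ∀ z, splitMatrix len C t z x *
      (if z = none then 1 else if z = t then -1 else d z) * splitMatrix len C t z y =
      branchMatrix len 1 0 z x * d z * branchMatrix len 1 0 z y +
        ((if z = none then (u + w) x * (u + w) y else 0) +
          if z = t then -((u - w) x * (u - w) y) else 0) := by
    intro z
    by_cases hz : z = none
    · subst hz
      simp [splitMatrix, h0, ht.symm, ← hu, ← hw]
    · by_cases hz' : z = t
      · subst hz'
        simp [splitMatrix, hdt, ht, ← hu, ← hw]
        ring
      · simp [splitMatrix, hz, hz']
  rw [Finset.sum_congr rfl fun z _ => key z, Finset.sum_add_distrib, Finset.sum_add_distrib,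
    Finset.sum_ite_eq', Finset.sum_ite_eq']
  simp only [Finset.mem_univ, if_true, Pi.add_apply, Pi.sub_apply]
  ring

/-- The second trapezoid is realized by matrices that are a direct sum of matrices of the branches
without the center, bordered by the entries at the center, with a free diagonal entry for all
branches but one pendant path. -/
theorem trapezoid_one_subset_inertiaSet_novaGraph (hlen : ∀ i, 1 ≤ len i) {n α β : ℕ}
    {i₀ : ι} (hi₀ : i₀ ∉ C) (hβ : Fintype.card ι = α + β)
    (hn : Fintype.card (Option (Σ i, Fin (len i))) = n) :
    inertiaTrapezoid 1 ((n : ℤ) - α - β + 1) n ⊆ (novaGraph len C).inertiaSet := by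
  rintro ⟨a, b⟩ ⟨ha, hb, h1, h2⟩
  dsimp only at ha hb h1 h2
  let s : ι → Option (Σ i, Fin (len i)) := fun i => some ⟨i, ⟨0, hlen i⟩⟩
  have hs : Function.Injective s := by
    intro i j h
    exact congrArg Sigma.fst (Option.some.inj h)
  have hcard : 1 ≤ Fintype.card ι := Fintype.card_pos_iff.2 ⟨i₀⟩
  have hU : (Finset.univ \ {none, s i₀} : Finset (Option (Σ i, Fin (len i)))).card = n - 2 := by
    rw [Finset.card_sdiff_of_subset (Finset.subset_univ _), Finset.card_univ, hn,
      Finset.card_pair (by simp [s])]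
  obtain ⟨d, hd0, hd, hda, hdb⟩ := exists_sign_vector
    (F := (Finset.univ.erase i₀).image s) (U := Finset.univ \ {none, s i₀})
    (by
      intro z hz
      obtain ⟨i, hi, rfl⟩ := Finset.mem_image.1 hz
      have : s i ≠ s i₀ := fun h => (Finset.mem_erase.1 hi).1 (hs h)
      simpa [s] using this)
    -- The weights `1` and `-1` of the two special rows supply the remaining positive and negative
    -- eigenvalue.
    (a := a - 1) (b := b - 1)
    (by
      rw [hU, Finset.card_image_of_injective _ hs,
        Finset.card_erase_of_mem (Finset.mem_univ _), Finset.card_univ]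
      lia)
    (by rw [hU]; lia)
  have hdn : d none = 0 := hd0 _ (by simp)
  have hdt : d (s i₀) = 0 := hd0 _ (by simp)
  have hd' : ∀ i (k : Fin (len i)), (k : ℕ) ≠ 0 → d (some ⟨i, k⟩) ≠ 0 := by
    intro i k hk
    have : ∀ j, s j ≠ some ⟨i, k⟩ := by
      intro j hj
      obtain rfl : j = i := congrArg Sigma.fst (Option.some.inj hj)
      have : k = ⟨0, hlen j⟩ := by simpa [s] using hj.symm
      exact hk (by rw [this])
    refine hd _ (by simpa using (this i₀).symm) ?_
    rw [Finset.mem_image]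
    rintro ⟨j, -, hj⟩
    exact this j hj
  refine ⟨(splitMatrix len C (s i₀))ᵀ *
    diagonal (fun z => if z = none then 1 else if z = s i₀ then -1 else d z) *
      splitMatrix len C (s i₀), ?_, ?_⟩
  · refine novaGraph_isRealization_of_entries (transpose_mul_diagonal_mul_isSymm _ _) ?_ ?_
    · intro y
      rw [splitMatrix_transpose_mul_diagonal_mul_apply (by simp [s]) hdn hdt,
        transpose_mul_diagonal_mul_branchMatrix_apply, novaGraph_adj_none_some]
      simp [branchMatrix_some_none, centerNeighbors, or_iff_not_imp_left]
    · intro x y hxy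
      rw [splitMatrix_transpose_mul_diagonal_mul_apply (by simp [s]) hdn hdt,
        ← transpose_mul_diagonal_mul_branchMatrix_ne_zero_iff (p := 1) (q := 0)
          (fun _ _ _ _ => one_ne_zero) hd' hxy]
      simp
  · obtain ⟨hpos, hneg⟩ := numEigenvalues_of_eq_transpose_mul_diagonal_mul
      (isUnit_splitMatrix hi₀ (hlen i₀))
      (fun z => if z = none then 1 else if z = s i₀ then -1 else d z) rfl
    rw [hpos, hneg]
    have hp : (Finset.univ.filter fun z =>
        0 < if z = none then (1 : ℝ) else if z = s i₀ then -1 else d z) =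
        insert none (Finset.univ.filter fun z => 0 < d z) := by
      ext z
      by_cases hz : z = none
      · simp [hz]
      · by_cases hz' : z = s i₀
        · subst hz'
          simp [hz, hdt]
        · simp [hz, hz']
    have hq : (Finset.univ.filter fun z =>
        (if z = none then (1 : ℝ) else if z = s i₀ then -1 else d z) < 0) =
        insert (s i₀) (Finset.univ.filter fun z => d z < 0) := by
      ext z
      by_cases hz : z = none
      · subst hz
        simp [hdn, s]
      · by_cases hz' : z = s i₀
        · subst hz'
          simp [hz]
        · simp [hz, hz']
    rw [hp, hq, Finset.card_insert_of_notMem (by simp [hdn]),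
      Finset.card_insert_of_notMem (by simp [hdt]), hda, hdb, Nat.sub_add_cancel ha,
      Nat.sub_add_cancel hb]

theorem inertiaSet_novaGraph (hlen : ∀ i, 1 ≤ len i) (hC : ∀ i ∈ C, 2 ≤ len i) {n α β : ℕ}
    (hα : C.card = α) (hβ : Fintype.card ι = α + β)
    (hn : Fintype.card (Option (Σ i, Fin (len i))) = n) :
    (novaGraph len C).inertiaSet =
      inertiaTrapezoid 0 ((n : ℤ) - α - 1) n ∪ inertiaTrapezoid 1 ((n : ℤ) - α - β + 1) n := by
  refine (inertiaSet_novaGraph_subset hlen hα hβ hn).antisymm ?_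
  have h0 := trapezoid_zero_subset_inertiaSet_novaGraph hlen hC hα hn
  refine Set.union_subset h0 ?_
  by_cases hi : ∃ i₀, i₀ ∉ C
  · obtain ⟨i₀, hi₀⟩ := hi
    exact trapezoid_one_subset_inertiaSet_novaGraph hlen hi₀ hβ hn
  -- Without pendant paths `β = 0`, and the second trapezoid lies in the first.
  · push Not at hi
    rw [← Finset.eq_univ_iff_forall] at hi
    rw [hi, Finset.card_univ] at hα
    rintro q ⟨-, -, h1, h2⟩
    exact h0 ⟨Nat.zero_le _, Nat.zero_le _, by lia, h2⟩

end

end SimpleGraph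

theorem lemma5p4 {V : Type*} [Fintype V] [DecidableEq V] (G : SimpleGraph V) (n α β : ℕ)
    (hn : Fintype.card V = n) (hG : G.IsSupernova α β) :
    G.inertiaSet =
      inertiaTrapezoid 0 ((n : ℤ) - α - 1) n ∪ inertiaTrapezoid 1 ((n : ℤ) - α - β + 1) n := by
  obtain ⟨len, hlen, hlen2, ⟨e⟩⟩ := hG.exists_novaGraph_iso
  rw [← e.inertiaSet_eq]
  refine SimpleGraph.inertiaSet_novaGraph hlen ?_ ?_ ?_ ?_
  · rintro (i | j) hi
    · exact hlen2 i
    · simp at hi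
  · rw [show (Finset.univ.filter fun i : Fin α ⊕ Fin β => i.isLeft) =
        Finset.univ.map Function.Embedding.inl by ext (i | j) <;> simp]
    simp
  · simp
  · rw [← hn]
    exact Fintype.card_congr e.toEquiv
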